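/- Let $\mathbb{F}_4$ be the field with four elements. For a set $W$ of positive integers, an $[n,k,W]_4$-code is a $k$-dimensional linear subspace $C\subseteq\mathbb{F}_4^n$ such that the Hamming weight of every non-zero codeword of $C$ lies in $W$. Such a code is called projective if the columns of a generator matrix of $C$ (a $k\times n$ matrix whose rows form a basis of $C$) are non-zero and pairwise linearly independent, i.e., they span $n$ pairwise different points of the projective space $\operatorname{PG}(k-1,4)$. Then no projective $[66,5,\{48,56\}]_4$-code exists. In particular, there is no projective two-weight code of length $66$ and dimension $5$ over $\mathbb{F}_4$ with non-zero weights $48$ and $56$. -/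

import Mathlib

open scoped LinearAlgebra.Projectivization

namespace LinearCode

/-- `G` is a generator matrix of the linear code `C`: its rows form a basis of `C`. -/
def IsGeneratorMatrix {F : Type*} [Field F] {k n : ℕ}
    (G : Matrix (Fin k) (Fin n) F) (C : Submodule F (Fin n → F)) : Prop :=
  LinearIndependent F G.row ∧ Submodule.span F (Set.range G.row) = C

/-- The multiset of points of `PG(k-1, q)` given by the columns of `G`, as a multiplicity
function: the number of columns that span the one-dimensional subspace `P`. -/
noncomputable def pointMultiplicity {F : Type*} [Field F] {k n : ℕ}
    (G : Matrix (Fin k) (Fin n) F) (P : ℙ F (Fin k → F)) : ℕ :=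
  Nat.card {j : Fin n // Submodule.span F {G.col j} = P.submodule}

/-- `C` is projective: the columns of a generator matrix are non-zero (so each of them spans a
point), and every point has multiplicity `0` or `1`. This does not depend on the choice of the
generator matrix. -/
def IsProjective {F : Type*} [Field F] {n : ℕ} (C : Submodule F (Fin n → F)) : Prop :=
  ∃ (k : ℕ) (G : Matrix (Fin k) (Fin n) F), IsGeneratorMatrix G C ∧
    (∀ j, G.col j ≠ 0) ∧ ∀ P : ℙ F (Fin k → F), pointMultiplicity G P ∈ ({0, 1} : Set ℕ)

/-- The set of Hamming weights of the non-zero codewords of `C`. -/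
def nonzeroWeights {F : Type*} [Field F] [DecidableEq F] {n : ℕ}
    (C : Submodule F (Fin n → F)) : Set ℕ :=
  {w | ∃ c ∈ C, c ≠ 0 ∧ hammingNorm c = w}

/-- `C` is an `[n, k, W]_q`-code: a `k`-dimensional subspace of `F ^ n`, where `F` is a field with
`q` elements, such that the weight of every non-zero codeword lies in `W`. -/
def IsCode {F : Type*} [Field F] [DecidableEq F] {n : ℕ}
    (C : Submodule F (Fin n → F)) (k : ℕ) (W : Set ℕ) (q : ℕ) : Prop :=
  Nat.card F = q ∧ Module.finrank F C = k ∧ nonzeroWeights C ⊆ W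

end LinearCode

/-! The proof passes to a residual code. Since no coordinate of `C` vanishes identically, the
average weight (`sum_hammingNorm`) exceeds 48, so some word `c₀` has weight 56. Restrict `C` to the
ten zeros of `c₀`. For `c` outside the line of `c₀`, `pencil_weights` gives 56 + (192 + 8m) = 4(56 +
w), where w is the restricted weight of `c`. Hence w = 6 + 2m, and w ≤ 10. The kernel of the
restriction is therefore the line of `c₀`, and the image is a [10,4,{6,8,10}]-code.

Such a code does not exist (`not_exists_ten_four`). In systematic form [I | A], each row of A has
exactly one zero, and these zeros lie in different columns (`row_zeros_ne`). Monomial changes put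
them on the diagonal and make the other entries of the first row and column 1. The remaining cases
form a finite search over `GF4` (`not_systematic_rows`). -/

/-! ### Computation in a concrete field with four elements. -/

/-- An explicit model of the field with four elements, with decidable operations. -/
inductive GF4 | zero | one | w | w2

namespace GF4

instance : DecidableEq GF4
  | zero, zero | one, one | w, w | w2, w2 => isTrue rfl
  | zero, one | zero, w | zero, w2 | one, zero | one, w | one, w2
  | w, zero | w, one | w, w2 | w2, zero | w2, one | w2, w => isFalse (by intro h; cases h)

instance : Fintype GF4 := ⟨{zero, one, w, w2}, by intro x; cases x <;> decide⟩

def add : GF4 → GF4 → GF4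
  | zero, y => y
  | x, zero => x
  | one, one => zero
  | one, w => w2
  | one, w2 => w
  | w, one => w2
  | w, w => zero
  | w, w2 => one
  | w2, one => w
  | w2, w => one
  | w2, w2 => zero

def mul : GF4 → GF4 → GF4
  | zero, _ => zero
  | _, zero => zero
  | one, y => y
  | x, one => x
  | w, w => w2
  | w, w2 => one
  | w2, w => one
  | w2, w2 => w

def inv : GF4 → GF4
  | w => w2
  | w2 => w
  | x => x

instance : Zero GF4 := ⟨zero⟩
instance : One GF4 := ⟨one⟩
instance : Add GF4 := ⟨add⟩
instance : Mul GF4 := ⟨mul⟩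
instance : Neg GF4 := ⟨id⟩
instance : Inv GF4 := ⟨inv⟩

instance : Field GF4 where
  add_assoc := by decide
  zero_add := by decide
  add_zero := by decide
  add_comm := by decide
  neg_add_cancel := by decide
  mul_assoc := by decide
  one_mul := by decide
  mul_one := by decide
  mul_comm := by decide
  left_distrib := by decide
  right_distrib := by decide
  zero_mul := by decide
  mul_zero := by decide
  exists_pair_ne := ⟨zero, one, by decide⟩
  mul_inv_cancel := by decide
  inv_zero := rfl
  nsmul := nsmulRec
  zsmul := zsmulRec
  nnqsmul := _
  qsmul := _

theorem card_eq : Fintype.card GF4 = 4 := rfl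

/-- The Hamming weight of a word of length six, in a form that evaluates quickly. -/
def weight (v : Fin 6 → GF4) : ℕ :=
  ([0, 1, 2, 3, 4, 5].map fun j => if v j = 0 then 0 else 1).sum

theorem hammingNorm_eq_weight (v : Fin 6 → GF4) : hammingNorm v = weight v := by
  simp only [hammingNorm, weight, Finset.card_filter, Fin.sum_univ_six, ite_not, List.map_cons,
    List.map_nil, List.sum_cons, List.sum_nil]
  ring

/-- The nonzero elements of the field. -/
def units : List GF4 := [one, w, w2]

theorem mem_units {x : GF4} (hx : x ≠ 0) : x ∈ units := by
  revert hx; revert x; decide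

/-- All combinations of two rows of the redundancy part with nonzero coefficients have a weight
that is allowed in a code of length ten with weights six, eight and ten. -/
def PairOK (r s : Fin 6 → GF4) : Prop :=
  ∀ a ∈ units, 2 + weight (fun j => r j + a * s j) ∈ [6, 8, 10]

/-- The analogue of `PairOK` for three rows. -/
def TripleOK (r s t : Fin 6 → GF4) : Prop :=
  ∀ a ∈ units, ∀ b ∈ units, 3 + weight (fun j => r j + a * s j + b * t j) ∈ [6, 8, 10]

instance (r s : Fin 6 → GF4) : Decidable (PairOK r s) := by unfold PairOK; infer_instance
instance (r s t : Fin 6 → GF4) : Decidable (TripleOK r s t) := by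
  unfold TripleOK; infer_instance

-- Exhaustive search. Each weight condition stands directly after the rows it involves, so that
-- failing branches are cut early. Up to a scalar the first coefficient is 1; combinations of all
-- four rows are not needed.
set_option synthInstance.maxSize 2000 in
set_option synthInstance.maxHeartbeats 400000 in
theorem not_systematic_rows :
    ∀ b₂ ∈ units, ∀ b₃ ∈ units, ∀ b₄ ∈ units, ∀ b₅ ∈ units,
    PairOK ![0, 1, 1, 1, 1, 1] ![1, 0, b₂, b₃, b₄, b₅] →
    ∀ c₁ ∈ units, ∀ c₃ ∈ units, ∀ c₄ ∈ units, ∀ c₅ ∈ units,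
    PairOK ![0, 1, 1, 1, 1, 1] ![1, c₁, 0, c₃, c₄, c₅] →
    PairOK ![1, 0, b₂, b₃, b₄, b₅] ![1, c₁, 0, c₃, c₄, c₅] →
    TripleOK ![0, 1, 1, 1, 1, 1] ![1, 0, b₂, b₃, b₄, b₅] ![1, c₁, 0, c₃, c₄, c₅] →
    ∀ d₁ ∈ units, ∀ d₂ ∈ units, ∀ d₄ ∈ units, ∀ d₅ ∈ units,
    PairOK ![0, 1, 1, 1, 1, 1] ![1, d₁, d₂, 0, d₄, d₅] →
    PairOK ![1, 0, b₂, b₃, b₄, b₅] ![1, d₁, d₂, 0, d₄, d₅] →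
    PairOK ![1, c₁, 0, c₃, c₄, c₅] ![1, d₁, d₂, 0, d₄, d₅] →
    TripleOK ![0, 1, 1, 1, 1, 1] ![1, 0, b₂, b₃, b₄, b₅] ![1, d₁, d₂, 0, d₄, d₅] →
    TripleOK ![0, 1, 1, 1, 1, 1] ![1, c₁, 0, c₃, c₄, c₅] ![1, d₁, d₂, 0, d₄, d₅] →
    ¬ TripleOK ![1, 0, b₂, b₃, b₄, b₅] ![1, c₁, 0, c₃, c₄, c₅] ![1, d₁, d₂, 0, d₄, d₅] := by
  decide +kernel

end GF4

/-! ### Normal form of the redundancy part of a systematic generator matrix. -/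

open Matrix

namespace LinearCode

/-- The systematic generator matrix `[I | A]` generates a code of length ten all of whose
non-zero words have weight six, eight or ten. -/
def IsEvenRedundancy {F : Type*} [Field F] [DecidableEq F] (A : Matrix (Fin 4) (Fin 6) F) : Prop :=
  ∀ x : Fin 4 → F, x ≠ 0 → hammingNorm x + hammingNorm (x ᵥ* A) ∈ [6, 8, 10]

namespace IsEvenRedundancy

variable {F : Type*} [Field F] [DecidableEq F] {A : Matrix (Fin 4) (Fin 6) F}

theorem permute (h : IsEvenRedundancy A) (σ : Equiv.Perm (Fin 6)) :
    IsEvenRedundancy (A.submatrix id σ) := by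
  intro x hx
  have hA : hammingNorm (x ᵥ* A.submatrix id σ) = hammingNorm (x ᵥ* A) := by
    refine Finset.card_equiv σ fun j => ?_
    simp only [Finset.mem_filter, Finset.mem_univ, true_and]
    rfl
  rw [hA]
  exact h x hx

theorem rescale (h : IsEvenRedundancy A) {s : Fin 4 → F} {t : Fin 6 → F} (hs : ∀ i, s i ≠ 0)
    (ht : ∀ j, t j ≠ 0) : IsEvenRedundancy (Matrix.of fun i j => s i * A i j * t j) := by
  intro x hx
  have h₁ : hammingNorm x = hammingNorm (fun i => x i * s i) := by
    simp [hammingNorm, hs]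
  have h₂ : hammingNorm (x ᵥ* Matrix.of fun i j => s i * A i j * t j) =
      hammingNorm ((fun i => x i * s i) ᵥ* A) := by
    have (j : Fin 6) : (x ᵥ* Matrix.of fun i j => s i * A i j * t j) j =
        ((fun i => x i * s i) ᵥ* A) j * t j := by
      simp only [vecMul, dotProduct, Finset.sum_mul, Matrix.of_apply]
      exact Finset.sum_congr rfl fun i _ => by ring
    simp [hammingNorm, this, ht]
  rw [h₁, h₂]
  refine h _ fun h0 => hx ?_
  funext i
  simpa [hs] using congrFun h0 i

/-- Transports the problem from an abstract field of order four to `GF4`, where it can be decided.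
-/
theorem map {K : Type*} [Field K] [DecidableEq K] (h : IsEvenRedundancy A) (φ : F ≃+* K) :
    IsEvenRedundancy (A.map φ) := by
  intro x hx
  have h₁ : hammingNorm x = hammingNorm (fun i => φ.symm (x i)) := by
    simp [hammingNorm]
  have h₂ : hammingNorm (x ᵥ* A.map φ) = hammingNorm ((fun i => φ.symm (x i)) ᵥ* A) := by
    have (j : Fin 6) : (x ᵥ* A.map φ) j = φ (((fun i => φ.symm (x i)) ᵥ* A) j) := by
      simp [vecMul, dotProduct, map_sum]
    simp [hammingNorm, this]
  rw [h₁, h₂]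
  refine h _ fun h0 => hx ?_
  funext i
  simpa using congrFun h0 i

theorem exists_row_zero (h : IsEvenRedundancy A) (i : Fin 4) :
    ∃ z, A i z = 0 ∧ ∀ j, j ≠ z → A i j ≠ 0 := by
  -- The word has weight 1 plus that of the row, which is at most 6; of 6, 8, 10 only 6 is possible.
  have hi := h (Pi.single i 1) (by simp)
  have h₁ : hammingNorm (Pi.single i (1 : F) : Fin 4 → F) = 1 := by
    exact Finset.card_eq_one.mpr ⟨i, by ext; simp [Pi.single_apply]⟩
  rw [h₁, Matrix.single_one_vecMul] at hi
  have h₂ : hammingNorm (A i) ≤ 6 := by simpa using hammingNorm_le_card_fintype (x := A i)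
  have h₃ : (Finset.univ.filter fun j => A i j ≠ 0).card = 5 := by
    change hammingNorm (A i) = 5
    simp only [List.mem_cons, List.not_mem_nil, or_false] at hi
    change 1 + hammingNorm (A i) = 6 ∨ 1 + hammingNorm (A i) = 8 ∨ 1 + hammingNorm (A i) = 10 at hi
    omega
  have h₄ := Finset.card_filter_add_card_filter_not (s := Finset.univ) (fun j => A i j ≠ 0)
  rw [h₃, Finset.card_univ, Fintype.card_fin] at h₄
  obtain ⟨z, hz⟩ := Finset.card_eq_one.mp (show (Finset.univ.filter fun j => ¬ A i j ≠ 0).card = 1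
    by omega)
  have hmem (j : Fin 6) : A i j = 0 ↔ j = z := by
    simpa using Finset.ext_iff.mp hz j
  exact ⟨z, (hmem z).2 rfl, fun j hj h0 => hj ((hmem j).1 h0)⟩

theorem vecMul_pair {K : Type*} [Field K] (A : Matrix (Fin 4) (Fin 6) K) {i i' : Fin 4} (a b : K) :
    (Pi.single i a + Pi.single i' b) ᵥ* A = fun j => a * A i j + b * A i' j := by
  funext j
  simp [add_vecMul, Matrix.single_vecMul]

theorem hammingNorm_pair {i i' : Fin 4} (hi : i ≠ i') {a b : F} (ha : a ≠ 0) (hb : b ≠ 0) :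
    hammingNorm (Pi.single i a + Pi.single i' b : Fin 4 → F) = 2 := by
  have : (Finset.univ.filter fun k => (Pi.single i a + Pi.single i' b : Fin 4 → F) k ≠ 0) =
      {i, i'} := by
    ext k
    by_cases h₁ : k = i
    · subst h₁; simp [hi, ha]
    · by_cases h₂ : k = i'
      · subst h₂; simp [h₁, hb]
      · simp [h₁, h₂]
  change Finset.card _ = 2
  rw [this, Finset.card_pair hi]

theorem pair (h : IsEvenRedundancy A) {i i' : Fin 4} (hi : i ≠ i') {a b : F} (ha : a ≠ 0)
    (hb : b ≠ 0) : 2 + hammingNorm (fun j => a * A i j + b * A i' j) ∈ [6, 8, 10] := by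
  have h₁ := hammingNorm_pair hi ha hb
  have h₂ := h (Pi.single i a + Pi.single i' b) (by
    intro h0; rw [h0, hammingNorm_zero] at h₁; omega)
  rwa [h₁, vecMul_pair] at h₂

theorem triple (h : IsEvenRedundancy A) {i i' i'' : Fin 4} (h₁ : i ≠ i') (h₂ : i ≠ i'')
    (h₃ : i' ≠ i'') {a b c : F} (ha : a ≠ 0) (hb : b ≠ 0) (hc : c ≠ 0) :
    3 + hammingNorm (fun j => a * A i j + b * A i' j + c * A i'' j) ∈ [6, 8, 10] := by
  have hn : hammingNorm (Pi.single i a + Pi.single i' b + Pi.single i'' c : Fin 4 → F) = 3 := by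
    have : (Finset.univ.filter fun k =>
        (Pi.single i a + Pi.single i' b + Pi.single i'' c : Fin 4 → F) k ≠ 0) = {i, i', i''} := by
      ext k
      by_cases e₁ : k = i
      · subst e₁; simp [h₁, h₂, ha]
      · by_cases e₂ : k = i'
        · subst e₂; simp [e₁, h₃, hb]
        · by_cases e₃ : k = i''
          · subst e₃; simp [e₁, e₂, hc]
          · simp [e₁, e₂, e₃]
    change Finset.card _ = 3
    rw [this, Finset.card_eq_three.mpr ⟨i, i', i'', h₁, h₂, h₃, rfl⟩]
  have hw := h (Pi.single i a + Pi.single i' b + Pi.single i'' c) (by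
    intro h0; rw [h0, hammingNorm_zero] at hn; omega)
  rw [hn, add_vecMul, vecMul_pair, Matrix.single_vecMul] at hw
  exact hw

/-- Two rows of the redundancy do not vanish in the same column: otherwise two of the five
quotients of their non-zero entries agree, which gives a word of weight at most five. -/
theorem row_zeros_ne [Fintype F] (hF : Fintype.card F = 4) (h : IsEvenRedundancy A) {i i' : Fin 4}
    (hi : i ≠ i') {z : Fin 6} (hz : A i z = 0) (hz' : A i' z = 0)
    (hn : ∀ j, j ≠ z → A i j ≠ 0) (hn' : ∀ j, j ≠ z → A i' j ≠ 0) : False := by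
  obtain ⟨y, hy, hcard⟩ := Finset.exists_lt_card_fiber_of_mul_lt_card_of_maps_to
    (s := Finset.univ.erase z) (t := Finset.univ.erase (0 : F)) (f := fun j => A i j / A i' j)
    (n := 1) (fun j hj => by
      have := (Finset.mem_erase.mp hj).1
      simp [hn j this, hn' j this]) (by simp [hF])
  have hy0 : y ≠ 0 := (Finset.mem_erase.mp hy).1
  have hw := h.pair hi one_ne_zero (neg_ne_zero.mpr hy0)
  have hsub : (Finset.univ.filter fun j => 1 * A i j + -y * A i' j ≠ 0) ⊆
      (Finset.univ.erase z).filter fun j => A i j / A i' j ≠ y := by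
    intro j hj
    have hj := (Finset.mem_filter.mp hj).2
    have hjz : j ≠ z := by rintro rfl; simp [hz, hz'] at hj
    simp only [Finset.mem_filter, Finset.mem_erase, Finset.mem_univ, and_true]
    refine ⟨hjz, fun hq => hj ?_⟩
    rw [div_eq_iff (hn' j hjz)] at hq
    rw [hq]; ring
  have h₁ := Finset.card_le_card hsub
  have h₂ := Finset.card_filter_add_card_filter_not (s := Finset.univ.erase z)
    (fun j => A i j / A i' j = y)
  simp only [Finset.card_erase_of_mem (Finset.mem_univ _), Finset.card_univ, Fintype.card_fin] at h₂
  change hammingNorm (fun j => 1 * A i j + -y * A i' j) ≤ _ at h₁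
  simp only [List.mem_cons, List.not_mem_nil, or_false] at hw
  simp only [ne_eq] at h₁
  omega

theorem not_normalized {A : Matrix (Fin 4) (Fin 6) GF4} (h : IsEvenRedundancy A)
    (hz : ∀ i : Fin 4, ∀ j : Fin 6, A i j = 0 ↔ j = Fin.castLE (by omega) i)
    (hr : ∀ j, j ≠ 0 → A 0 j = 1) (hc : ∀ i, i ≠ 0 → A i 0 = 1) : False := by
  have r₀ : A 0 = ![0, 1, 1, 1, 1, 1] := by
    funext j; fin_cases j
    · exact (hz 0 0).2 rfl
    all_goals exact hr _ (by decide)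
  have r₁ : A 1 = ![1, 0, A 1 2, A 1 3, A 1 4, A 1 5] := by
    funext j; fin_cases j
    · exact hc 1 (by decide)
    · exact (hz 1 1).2 rfl
    all_goals rfl
  have r₂ : A 2 = ![1, A 2 1, 0, A 2 3, A 2 4, A 2 5] := by
    funext j; fin_cases j
    · exact hc 2 (by decide)
    · rfl
    · exact (hz 2 2).2 rfl
    all_goals rfl
  have r₃ : A 3 = ![1, A 3 1, A 3 2, 0, A 3 4, A 3 5] := by
    funext j; fin_cases j
    · exact hc 3 (by decide)
    · rfl
    · rfl
    · exact (hz 3 3).2 rfl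
    all_goals rfl
  have hu (i : Fin 4) (j : Fin 6) (hij : j ≠ Fin.castLE (by omega) i) : A i j ∈ GF4.units :=
    GF4.mem_units fun h0 => hij ((hz i j).1 h0)
  have unit_ne : ∀ a ∈ GF4.units, a ≠ 0 := by decide
  have hp (i i' : Fin 4) (hi : i ≠ i') : GF4.PairOK (A i) (A i') := by
    intro a ha
    have := h.pair hi one_ne_zero (unit_ne a ha)
    simpa only [one_mul, GF4.hammingNorm_eq_weight] using this
  have ht (i i' i'' : Fin 4) (h₁ : i ≠ i') (h₂ : i ≠ i'') (h₃ : i' ≠ i'') :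
      GF4.TripleOK (A i) (A i') (A i'') := by
    intro a ha b hb
    have := h.triple h₁ h₂ h₃ one_ne_zero (unit_ne a ha) (unit_ne b hb)
    simpa only [one_mul, GF4.hammingNorm_eq_weight] using this
  refine GF4.not_systematic_rows
    (A 1 2) (hu _ _ (by decide)) (A 1 3) (hu _ _ (by decide))
    (A 1 4) (hu _ _ (by decide)) (A 1 5) (hu _ _ (by decide)) ?_
    (A 2 1) (hu _ _ (by decide)) (A 2 3) (hu _ _ (by decide))
    (A 2 4) (hu _ _ (by decide)) (A 2 5) (hu _ _ (by decide)) ?_ ?_ ?_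
    (A 3 1) (hu _ _ (by decide)) (A 3 2) (hu _ _ (by decide))
    (A 3 4) (hu _ _ (by decide)) (A 3 5) (hu _ _ (by decide)) ?_ ?_ ?_ ?_ ?_ ?_ <;>
  simp only [← r₀, ← r₁, ← r₂, ← r₃] <;>
  first
    | exact hp _ _ (by decide)
    | exact ht _ _ _ (by decide) (by decide) (by decide)

end IsEvenRedundancy

theorem not_isEvenRedundancy {F : Type*} [Field F] [DecidableEq F] [Fintype F]
    (hF : Fintype.card F = 4) (A : Matrix (Fin 4) (Fin 6) F) : ¬ IsEvenRedundancy A := by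
  intro h
  choose z hz hn using h.exists_row_zero
  have hinj : Function.Injective z := by
    intro i i' he
    by_contra hi
    exact h.row_zeros_ne hF hi (hz i) (he ▸ hz i') (hn i) (he ▸ hn i')
  -- The symmetric group on six columns is 4-transitive, so the four distinct zeros can be moved to
  -- the first four columns.
  obtain ⟨σ, hσ⟩ := (Equiv.Perm.isMultiplyPretransitive (Fin 6) 4).exists_smul_eq
    (Fin.castLEEmb (by omega)) ⟨z, hinj⟩
  have hσ (i : Fin 4) : σ (Fin.castLE (by omega) i) = z i := by
    simpa using DFunLike.congr_fun hσ i
  have hB := h.permute σ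
  set B := A.submatrix id σ with hBdef
  have hB0 (i : Fin 4) (j : Fin 6) : B i j = 0 ↔ j = Fin.castLE (by omega) i := by
    constructor
    · intro h0
      by_contra hj
      exact hn i (σ j) (fun he => hj (σ.injective (he.trans (hσ i).symm))) h0
    · rintro rfl
      change A i (σ _) = 0
      rw [hσ, hz]
  -- The two scalings do not interfere: they meet only at the corner entry, which is zero.
  let s : Fin 4 → F := fun i => if i = 0 then 1 else (B i 0)⁻¹
  let t : Fin 6 → F := fun j => if j = 0 then 1 else (B 0 j)⁻¹
  have hB0j (j : Fin 6) (hj : j ≠ 0) : B 0 j ≠ 0 := fun h0 => hj ((hB0 0 j).1 h0)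
  have hBi0 (i : Fin 4) (hi : i ≠ 0) : B i 0 ≠ 0 := fun h0 => hi (by
    have := congrArg Fin.val ((hB0 i 0).1 h0)
    exact Fin.ext this.symm)
  have hs (i : Fin 4) : s i ≠ 0 := by
    by_cases hi : i = 0 <;> simp [s, hi, hBi0]
  have ht (j : Fin 6) : t j ≠ 0 := by
    by_cases hj : j = 0 <;> simp [t, hj, hB0j]
  refine ((hB.rescale hs ht).map (FiniteField.ringEquivOfCardEq
    (K' := GF4) (hF.trans GF4.card_eq.symm))).not_normalized ?_ ?_ ?_
  · intro i j
    simp [hs, ht, hB0]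
  · intro j hj
    simp [s, t, hj, hB0j j hj]
  · intro i hi
    simp [s, t, hi, hBi0 i hi]

end LinearCode

/-! ### Information sets and weight counts. -/

namespace LinearCode

/-- A finite-dimensional code has an information set: coordinates `a` together with codewords that
restrict to the standard basis on them. -/
theorem exists_information_set {F ι : Type*} [Field F] [Fintype ι]
    (D : Submodule F (ι → F)) {k : ℕ} (hD : Module.finrank F D = k) :
    ∃ (a : Fin k → ι) (r : Fin k → D), Function.Injective a ∧
      ∀ i j, (r i : ι → F) (a j) = (Pi.single i 1 : Fin k → F) j := by
  let φ : ι → Module.Dual F D := fun j => (LinearMap.proj j).comp D.subtype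
  -- A maximal independent family of coordinate functionals: a word on which it vanishes vanishes
  -- everywhere, so evaluation `ψ` is injective, and independence bounds the size of the family by
  -- `k`.
  obtain ⟨κ, a, ha, hspan, hli⟩ := exists_linearIndependent' F φ
  have : Finite κ := Finite.of_injective a ha
  have := Fintype.ofFinite κ
  let ψ : D →ₗ[F] (κ → F) := LinearMap.pi fun i => φ (a i)
  have hψ : Function.Injective ψ := by
    rw [injective_iff_map_eq_zero]
    intro d hd
    ext j
    have hle : Submodule.span F (Set.range (φ ∘ a)) ≤
        LinearMap.ker (Module.Dual.eval F D d) := by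
      rw [Submodule.span_le]
      rintro _ ⟨i, rfl⟩
      exact congrFun hd i
    rw [hspan] at hle
    exact hle (Submodule.subset_span ⟨j, rfl⟩)
  have h₁ : Fintype.card κ ≤ k := by
    have := hli.fintype_card_le_finrank
    rwa [Subspace.dual_finrank_eq, hD] at this
  have h₂ : k ≤ Fintype.card κ := by
    have := LinearMap.finrank_le_finrank_of_injective hψ
    rwa [hD, Module.finrank_fintype_fun_eq_card] at this
  have hcard : Fintype.card κ = k := le_antisymm h₁ h₂
  have hsurj : Function.Surjective ψ :=
    (LinearMap.injective_iff_surjective_of_finrank_eq_finrank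
      (by rw [hD, Module.finrank_fintype_fun_eq_card, hcard])).1 hψ
  let e : Fin k ≃ κ := (Fintype.equivFinOfCardEq hcard).symm
  choose r hr using fun i : Fin k => hsurj fun j => (Pi.single i 1 : Fin k → F) (e.symm j)
  refine ⟨a ∘ e, r, ha.comp e.injective, fun i j => ?_⟩
  have := congrFun (hr i) (e j)
  rw [e.symm_apply_apply] at this
  exact this

/-- There is no quaternary `[10, 4, {6, 8, 10}]`-code. -/
theorem not_exists_ten_four {F ι : Type*} [Field F] [DecidableEq F] [Fintype F] [Fintype ι]
    (hF : Fintype.card F = 4) (hι : Fintype.card ι = 10) (D : Submodule F (ι → F))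
    (hD : Module.finrank F D = 4)
    (hw : ∀ d ∈ D, d ≠ 0 → hammingNorm d ∈ [6, 8, 10]) : False := by
  classical
  obtain ⟨a, r, ha, hr⟩ := exists_information_set D hD
  have hcompl : Fintype.card ((Set.range a)ᶜ : Set ι) = 6 := by
    rw [Fintype.card_compl_set, hι, Set.card_range_of_injective ha, Fintype.card_fin]
  let e : Fin 4 ⊕ Fin 6 ≃ ι := ((Equiv.ofInjective a ha).sumCongr
    (Fintype.equivFinOfCardEq hcompl).symm).trans (Equiv.Set.sumCompl (Set.range a))
  have he (i : Fin 4) : e (Sum.inl i) = a i := rfl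
  refine not_isEvenRedundancy hF (Matrix.of fun i j => (r i : ι → F) (e (Sum.inr j))) ?_
  intro x hx
  let d : D := ∑ i, x i • r i
  have hd (j : ι) : (d : ι → F) j = ∑ i, x i * (r i : ι → F) j := by
    simp [d]
  have hda (i : Fin 4) : (d : ι → F) (e (Sum.inl i)) = x i := by
    simp [hd, he, hr, Pi.single_apply]
  have hd0 : (d : ι → F) ≠ 0 := fun h0 => hx (by
    funext i
    rw [← hda i, h0]
    rfl)
  have hsplit : hammingNorm (d : ι → F) = hammingNorm x +
      hammingNorm (x ᵥ* Matrix.of fun i j => (r i : ι → F) (e (Sum.inr j))) := by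
    simp only [hammingNorm, Finset.card_filter]
    rw [← e.sum_comp, Fintype.sum_sum_type]
    simp only [hda, hd, vecMul, dotProduct, Matrix.of_apply]
    congr!
  rw [← hsplit]
  exact hw _ d.2 hd0

/-- A code without identically vanishing coordinate has average weight `n (q - 1) / q`. -/
theorem sum_hammingNorm {F : Type*} [Field F] [DecidableEq F] [Fintype F] {n k : ℕ}
    (C : Submodule F (Fin n → F)) [Fintype C] (hk : Module.finrank F C = k + 1)
    (hC : ∀ j, ∃ c ∈ C, c j ≠ 0) :
    ∑ c : C, hammingNorm (c : Fin n → F) =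
      n * (Fintype.card F ^ (k + 1) - Fintype.card F ^ k) := by
  classical
  simp only [hammingNorm, Finset.card_filter]
  rw [Finset.sum_comm]
  -- Double counting by coordinates: each is a non-zero functional, so its kernel is a hyperplane of
  -- `C`.
  have hj (j : Fin n) : ∑ c : C, (if (c : Fin n → F) j ≠ 0 then 1 else 0) =
      Fintype.card F ^ (k + 1) - Fintype.card F ^ k := by
    let f : Module.Dual F C := (LinearMap.proj j).comp C.subtype
    have hf : f ≠ 0 := by
      obtain ⟨c, hc, hcj⟩ := hC j
      exact fun h0 => hcj (LinearMap.congr_fun h0 ⟨c, hc⟩)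
    have hker : Fintype.card (LinearMap.ker f) = Fintype.card F ^ k := by
      have := Module.Dual.finrank_ker_add_one_of_ne_zero hf
      rw [Module.card_eq_pow_finrank (K := F), show Module.finrank F (LinearMap.ker f) = k by omega]
    have hker' : (Finset.univ.filter fun c : C => (c : Fin n → F) j = 0).card =
        Fintype.card F ^ k := by
      rw [← hker, Fintype.card_subtype]
      congr 1
      ext c
      simp only [Finset.mem_filter, Finset.mem_univ, true_and]
      rfl
    have := Finset.card_filter_add_card_filter_not (s := (Finset.univ : Finset C))
      (fun c : C => (c : Fin n → F) j = 0)
    rw [hker', Finset.card_univ, Module.card_eq_pow_finrank (K := F) (V := C), hk] at this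
    rw [← Finset.card_filter]
    simp only [ne_eq]
    omega
  calc _ = ∑ _j : Fin n, (Fintype.card F ^ (k + 1) - Fintype.card F ^ k) :=
        Finset.sum_congr rfl fun j _ => by convert hj j
    _ = _ := by simp

/-- The words on the line spanned by `c₀` and `c`: their weights sum up to `q` times the number of
coordinates in which not both words vanish. -/
theorem pencil_weights {F ι : Type*} [Field F] [DecidableEq F] [Fintype F] [Fintype ι]
    (c₀ c : ι → F) :
    hammingNorm c₀ + ∑ a : F, hammingNorm (c + a • c₀) =
      Fintype.card F * (hammingNorm c₀ + hammingNorm fun j : {j // c₀ j = 0} => c j) := by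
  classical
  have hZ : hammingNorm (fun j : {j // c₀ j = 0} => c j) =
      ∑ j, if c₀ j = 0 ∧ c j ≠ 0 then 1 else 0 := by
    rw [← Finset.card_filter, hammingNorm, ← Finset.card_map (Function.Embedding.subtype _)]
    congr 1
    ext j
    simp [and_comm]
  rw [hZ]
  simp only [hammingNorm, Finset.card_filter]
  rw [Finset.sum_comm, ← Finset.sum_add_distrib, ← Finset.sum_add_distrib, Finset.mul_sum]
  refine Finset.sum_congr rfl fun j _ => ?_
  by_cases h₀ : c₀ j = 0
  · by_cases h₁ : c j = 0 <;> simp [h₀, h₁]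
  -- Here exactly one `a` kills the coordinate, leaving q - 1 contributions; `c₀` itself supplies
  -- the q-th.
  · have hroot (a : F) : c j + a * c₀ j = 0 ↔ a = -c j / c₀ j := by
      rw [eq_div_iff h₀]
      exact ⟨fun h => by linear_combination h, fun h => by linear_combination h⟩
    have hpos : 0 < Fintype.card F := Fintype.card_pos
    simp only [Pi.add_apply, Pi.smul_apply, smul_eq_mul, ne_eq, hroot, ← Finset.card_filter]
    rw [Finset.filter_ne' , Finset.card_erase_of_mem (Finset.mem_univ _)]
    simp [h₀]
    omega

end LinearCode

/-! ### The residual code of a word of weight 56. -/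

theorem mainTheorem2 {F : Type*} [Field F] [DecidableEq F] :
    ¬ ∃ C : Submodule F (Fin 66 → F),
      LinearCode.IsCode C 5 {48, 56} 4 ∧ LinearCode.IsProjective C := by
  rintro ⟨C, ⟨hF, hdim, hW⟩, k, G, ⟨-, hspan⟩, hcol, -⟩
  have : Finite F := Nat.finite_of_card_ne_zero (by omega)
  have := Fintype.ofFinite F
  have := Fintype.ofFinite C
  rw [Nat.card_eq_fintype_card] at hF
  have hC (j : Fin 66) : ∃ c ∈ C, c j ≠ 0 := by
    obtain ⟨i, hi⟩ := Function.ne_iff.mp (hcol j)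
    exact ⟨G.row i, hspan ▸ Submodule.subset_span ⟨i, rfl⟩, hi⟩
  have hw (c : Fin 66 → F) (hc : c ∈ C) (h0 : c ≠ 0) :
      hammingNorm c = 48 ∨ hammingNorm c = 56 := by
    simpa using hW ⟨c, hc, h0, rfl⟩
  -- Otherwise the weights sum to at most 48 · 1024 = 49152, but the sum is 66 · 768 = 50688.
  obtain ⟨c₀, hc₀, hc₀w⟩ : ∃ c ∈ C, hammingNorm c = 56 := by
    by_contra! hne
    have hle (c : C) : hammingNorm (c : Fin 66 → F) ≤ 48 := by
      by_cases h0 : (c : Fin 66 → F) = 0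
      · simp [h0]
      · have := hw c c.2 h0
        have := hne c c.2
        omega
    have h₁ := LinearCode.sum_hammingNorm C hdim hC
    have h₂ := Finset.sum_le_card_nsmul Finset.univ _ 48 fun c (_ : c ∈ Finset.univ) => hle c
    rw [h₁, Finset.card_univ, Module.card_eq_pow_finrank (K := F) (V := C), hdim, hF] at h₂
    norm_num at h₂
  have hZ : Fintype.card {j // c₀ j = 0} = 10 := by
    rw [Fintype.card_subtype]
    have := Finset.card_filter_add_card_filter_not (s := Finset.univ) (fun j => c₀ j = 0)
    change _ + hammingNorm c₀ = _ at this
    rw [hc₀w, Finset.card_univ, Fintype.card_fin] at this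
    omega
  have hc₀0 : c₀ ≠ 0 := by rintro rfl; simp at hc₀w
  let ρ : C →ₗ[F] ({j // c₀ j = 0} → F) := (LinearMap.funLeft F F Subtype.val).comp C.subtype
  have hρ (c : C) : c ∈ Submodule.span F {(⟨c₀, hc₀⟩ : C)} ∨ hammingNorm (ρ c) ∈ [6, 8, 10] := by
    rw [or_iff_not_imp_left]
    intro hc
    have hpencil := LinearCode.pencil_weights c₀ c
    have hmem (a : F) : hammingNorm ((c : Fin 66 → F) + a • c₀) = 48 ∨
        hammingNorm ((c : Fin 66 → F) + a • c₀) = 56 := by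
      refine hw _ (C.add_mem c.2 (C.smul_mem a hc₀)) fun h0 => hc ?_
      rw [Submodule.mem_span_singleton]
      refine ⟨-a, Subtype.ext ?_⟩
      simpa using (eq_neg_of_add_eq_zero_left h0).symm
    have hle : hammingNorm (ρ c) ≤ 10 := hZ ▸ hammingNorm_le_card_fintype
    -- 192 = 4 · 48, and `m` counts the words of weight 56 among the four.
    obtain ⟨m, hm⟩ : ∃ m, ∑ a : F, hammingNorm ((c : Fin 66 → F) + a • c₀) = 192 + 8 * m := by
      choose b hb using fun a : F => show ∃ b, hammingNorm ((c : Fin 66 → F) + a • c₀) = 48 + 8 * b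
        from (hmem a).elim (fun h => ⟨0, h⟩) (fun h => ⟨1, h⟩)
      refine ⟨∑ a, b a, ?_⟩
      simp [hb, Finset.sum_add_distrib, Finset.mul_sum, hF]
    rw [hm, hF, hc₀w] at hpencil
    change 56 + (192 + 8 * m) = 4 * (56 + hammingNorm (ρ c)) at hpencil
    simp only [List.mem_cons, List.not_mem_nil, or_false]
    omega
  -- A word that restricts to zero has restricted weight 0, which is not among 6, 8, 10.
  have hker : LinearMap.ker ρ = Submodule.span F {(⟨c₀, hc₀⟩ : C)} := by
    refine le_antisymm (fun c hc => ?_) ?_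
    · refine (hρ c).resolve_right ?_
      rw [LinearMap.mem_ker.mp hc]
      simp
    · rw [Submodule.span_singleton_le_iff_mem, LinearMap.mem_ker]
      funext j
      exact j.2
  refine LinearCode.not_exists_ten_four hF hZ (LinearMap.range ρ) ?_ ?_
  · have := LinearMap.finrank_range_add_finrank_ker ρ
    rw [hker, finrank_span_singleton (by simpa [Subtype.ext_iff] using hc₀0), hdim] at this
    omega
  · rintro _ ⟨c, rfl⟩ h0
    refine (hρ c).resolve_left fun hc => h0 ?_
    rwa [← hker] at hc
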